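/- Identify $x=(x_1,x_2)\in\mathbb R^2$ with $z=x_1+ix_2\in\mathbb C$. For $E>0$ and $\lambda\in\mathbb C\setminus\{0\}$ let $k(\lambda)=(k_1,k_2)\in\mathbb C^2$ with $$k_1=\Big(\lambda+\frac1\lambda\Big)\frac{\sqrt E}{2},\qquad k_2=\Big(\frac1\lambda-\lambda\Big)\frac{i\sqrt E}{2},$$ and let the Faddeev Green function be $$g(z,k)=-\frac1{(2\pi)^2}\int_{\mathbb R^2}\frac{e^{i\xi\cdot x}}{|\xi|^2+2k\cdot\xi}\,d\xi,\qquad k\cdot\xi=k_1\xi_1+k_2\xi_2,$$ where the integral, which does not converge absolutely at infinity, is the limit as $R\to\infty$ of the integrals over the discs $|\xi|<R$. Let $f(\tau)=\ln\frac1\tau$ for $0<\tau<\frac12$ and $f(\tau)=\frac1\tau$ for $\tau\ge\frac12$. For all $E>0$ and all $z,\lambda\in\mathbb C\setminus\{0\}$ with $|\lambda|\notin[\frac12,2]$, the integrand is absolutely integrable on every disc and the limit defining $g(z,k(\lambda))$ exists. There is an absolute constant $C>0$ such that for all such $E,z,\lambda$ $$|g(z,k(\lambda))|\le C\,f\Big(|z|\sqrt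 E\,\Big(|\lambda|+\frac1{|\lambda|}\Big)\Big).$$ Consequently, for every $\alpha\in(0,1]$ there is a constant $c(\alpha)>0$, depending only on $\alpha$, such that for all such $E,z,\lambda$ $$|g(z,k(\lambda))|\le\frac{c(\alpha)}{\big[|z|\sqrt E\,(|\lambda|+1/|\lambda|)\big]^{\alpha}}.$$ -/

import Mathlib

open MeasureTheory Filter Topology

noncomputable section

namespace Faddeev

/-- The vector `k(λ) = (k₁, k₂) ∈ ℂ²` with `k₁ = (λ + 1/λ) √E / 2`, `k₂ = (1/λ - λ) i √E / 2`. -/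
def kvec (E : ℝ) (lam : ℂ) : Fin 2 → ℂ :=
  ![(lam + 1 / lam) * ((Real.sqrt E : ℂ) / 2),
    (1 / lam - lam) * (Complex.I * (Real.sqrt E : ℂ) / 2)]

/-- The symbol `|ξ|² + 2 k · ξ`, where `ξ = (ξ₁, ξ₂) ∈ ℝ²` is written as the complex number
`ξ₁ + i ξ₂` and `k · ξ = k₁ ξ₁ + k₂ ξ₂` (no conjugation). -/
def symbol (k : Fin 2 → ℂ) (ξ : ℂ) : ℂ :=
  ((‖ξ‖ ^ 2 : ℝ) : ℂ) + 2 * (k 0 * (ξ.re : ℂ) + k 1 * (ξ.im : ℂ))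

/-- The integrand `e^{i ξ · x} / (|ξ|² + 2 k · ξ)`, with `z = x₁ + i x₂` and
`ξ · x = ξ₁ x₁ + ξ₂ x₂`. -/
def integrand (k : Fin 2 → ℂ) (z ξ : ℂ) : ℂ :=
  Complex.exp (Complex.I * ((ξ.re * z.re + ξ.im * z.im : ℝ) : ℂ)) / symbol k ξ

/-- The integral of the integrand over the disc `|ξ| < R`. -/
def truncated (k : Fin 2 → ℂ) (z : ℂ) (R : ℝ) : ℂ :=
  ∫ ξ in Metric.ball (0 : ℂ) R, integrand k z ξ

/-- The integral over the plane converges: the integrand is absolutely integrable on every disc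
(in particular near the zeros of the symbol), and the integrals over the discs `|ξ| < R` have a
limit as `R → ∞`. (At infinity the integrand is only of size `|ξ|⁻²`, so that the integral over
the plane never converges absolutely.) -/
def Converges (k : Fin 2 → ℂ) (z : ℂ) : Prop :=
  (∀ R : ℝ, IntegrableOn (integrand k z) (Metric.ball (0 : ℂ) R)) ∧
    ∃ I : ℂ, Tendsto (truncated k z) atTop (𝓝 I)

/-- The Faddeev Green function
`g(z, k) = -(2π)⁻² ∫_{ℝ²} e^{i ξ · x} / (|ξ|² + 2 k · ξ) dξ`, the integral being
the limit of the integrals over `|ξ| < R` as `R → ∞`. -/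
def green (z : ℂ) (k : Fin 2 → ℂ) : ℂ :=
  -(1 / (2 * (Real.pi : ℂ)) ^ 2) * limUnder atTop (truncated k z)

/-- The function `f(τ) = ln (1/τ)` for `0 < τ < 1/2`, `f(τ) = 1/τ` for `τ ≥ 1/2`. -/
def majorant (τ : ℝ) : ℝ :=
  if τ < 1 / 2 then Real.log (1 / τ) else 1 / τ

/-- The quantity `|z| √E (|λ| + 1/|λ|)`. -/
def scale (E : ℝ) (lam z : ℂ) : ℝ :=
  ‖z‖ * Real.sqrt E * (‖lam‖ + 1 / ‖lam‖)

end Faddeev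

end

namespace Faddeev

open scoped ENNReal ComplexConjugate

/-! ### Integrals of powers of the norm over discs, annuli and exteriors. -/

section Radial

/-! Put `ρ = √E (λ + 1/conj λ)` and `β = (|λ|² - 1)/(|λ|² + 1)`. The symbol is `|ξ|² + Re(ρ conj ξ)
+ iβ Im(ρ conj ξ)` (`symbol_kvec`), and with `β = 1` its modulus would be exactly `|ξ| |ξ + ρ|`.
Keeping `|λ|` off `[1/2, 2]` forces `3/5 ≤ |β| ≤ 1`, so the symbol is uniformly comparable with `|ξ|
|ξ + ρ|`: two integrable point singularities and decay `|ξ|⁻²`. Moreover `|z| |ρ|` is the scale `τ`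
of the theorem.

Oscillation supplies the missing decay. Translating `ξ` by `h = π z/|z|²` changes the sign of the
plane wave, so four times the integral of the wave against `1/symbol` is its integral against a
second difference of `1/symbol`, up to errors from moving the disc, which vanish as `R → ∞`
(`four_mul_integral_ball`, `tendsto_integral_ball_sub`). The second difference is absolutely
integrable, which gives both the limit and the bound. A first difference would already decay fast
enough at infinity, but near a zero it is only of size `|h| |ρ|⁻¹ |ξ|⁻²`, which costs a logarithm;
the second difference gains one more power (`norm_secondDiff_le`).

Within distance `2|h|` of the zeros the three terms are estimated separately, and elsewhere
cancellation is used. Both regions contribute `O(|h|/|ρ|) = O(1/τ)`. When `|ρ| ≤ |h|`, the far part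
is `O(1)` and the near part is `O(1 + log(2|h|/|ρ|))`, the logarithm coming from `|ξ|⁻²` between the
scales `|ρ|` and `|h|`. -/

lemma lintegral_comp_norm {F : ℝ → ℝ≥0∞} (hF : Measurable F) :
    ∫⁻ ξ : ℂ, F ‖ξ‖ = ENNReal.ofReal (2 * Real.pi) *
      ∫⁻ r in Set.Ioi (0 : ℝ), ENNReal.ofReal r * F r := by
  have hm : Measurable fun r : ℝ => ENNReal.ofReal r * F r := by fun_prop
  rw [← Complex.lintegral_comp_polarCoord_symm, polarCoord_target,
    Measure.volume_eq_prod, ← Measure.prod_restrict]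
  have h1 : ∀ᵐ p ∂((volume.restrict (Set.Ioi (0 : ℝ))).prod
      (volume.restrict (Set.Ioo (-Real.pi) Real.pi))),
      ENNReal.ofReal p.1 • F ‖Complex.polarCoord.symm p‖ = ENNReal.ofReal p.1 * F p.1 := by
    rw [Measure.prod_restrict]
    filter_upwards [ae_restrict_mem (measurableSet_Ioi.prod measurableSet_Ioo)] with p hp
    have hp1 : 0 < p.1 := hp.1
    rw [Complex.norm_polarCoord_symm, abs_of_pos hp1, smul_eq_mul]
  rw [lintegral_congr_ae h1, lintegral_prod (fun p : ℝ × ℝ => ENNReal.ofReal p.1 * F p.1)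
    (hm.comp measurable_fst).aemeasurable]
  simp only [lintegral_const, Measure.restrict_apply MeasurableSet.univ, Set.univ_inter,
    Real.volume_Ioo]
  rw [lintegral_mul_const _ hm, mul_comm]
  congr 2
  ring

/-- The integral of a negative power of the norm over a rotation invariant set. -/
lemma setLIntegral_norm_inv_pow {s : Set ℝ} (hs : MeasurableSet s) (n : ℕ) :
    ∫⁻ ξ in {ξ : ℂ | ‖ξ‖ ∈ s}, ENNReal.ofReal (‖ξ‖⁻¹ ^ n) = ENNReal.ofReal (2 * Real.pi) *
      ∫⁻ r in s ∩ Set.Ioi (0 : ℝ), ENNReal.ofReal (r * r⁻¹ ^ n) := by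
  have hm : MeasurableSet {ξ : ℂ | ‖ξ‖ ∈ s} := measurable_norm hs
  have := lintegral_comp_norm (F := s.indicator fun r => ENNReal.ofReal (r⁻¹ ^ n))
    (Measurable.indicator (by fun_prop) hs)
  have hl : ∫⁻ ξ in {ξ : ℂ | ‖ξ‖ ∈ s}, ENNReal.ofReal (‖ξ‖⁻¹ ^ n) =
      ∫⁻ ξ : ℂ, s.indicator (fun r => ENNReal.ofReal (r⁻¹ ^ n)) ‖ξ‖ := by
    rw [← lintegral_indicator hm]
    rfl
  rw [hl, this, ← Measure.restrict_restrict hs, ← lintegral_indicator hs]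
  congr 1
  refine setLIntegral_congr_fun measurableSet_Ioi fun x hx => ?_
  by_cases h : x ∈ s <;> simp [h, ENNReal.ofReal_mul (le_of_lt (Set.mem_Ioi.1 hx))]

lemma setLIntegral_ball_norm_inv (r : ℝ) :
    ∫⁻ ξ in Metric.ball (0 : ℂ) r, ENNReal.ofReal ‖ξ‖⁻¹ = ENNReal.ofReal (2 * Real.pi * r) := by
  have h := setLIntegral_norm_inv_pow (measurableSet_Iio (a := r)) 1
  have hb : {ξ : ℂ | ‖ξ‖ ∈ Set.Iio r} = Metric.ball 0 r := by ext; simp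
  simp only [pow_one] at h
  rw [hb] at h
  rw [h, Set.inter_comm, Set.Ioi_inter_Iio, setLIntegral_congr_fun (g := fun _ => 1) measurableSet_Ioo]
  · simp [ENNReal.ofReal_mul Real.two_pi_pos.le]
  · intro x hx
    simp [mul_inv_cancel₀ hx.1.ne']

lemma setLIntegral_annulus_norm_inv_sq {a b : ℝ} (ha : 0 < a) (hab : a ≤ b) :
    ∫⁻ ξ in {ξ : ℂ | ‖ξ‖ ∈ Set.Ioc a b}, ENNReal.ofReal (‖ξ‖⁻¹ ^ 2) =
      ENNReal.ofReal (2 * Real.pi * Real.log (b / a)) := by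
  rw [setLIntegral_norm_inv_pow measurableSet_Ioc, Set.inter_eq_left.2
    (show Set.Ioc a b ⊆ Set.Ioi 0 from fun x hx => ha.trans hx.1), ENNReal.ofReal_mul Real.two_pi_pos.le]
  congr 1
  have h0 : (0 : ℝ) ∉ Set.uIcc a b := by
    rw [Set.uIcc_of_le hab]; exact fun h => absurd h.1 (not_le.2 ha)
  rw [← integral_inv h0, intervalIntegral.integral_of_le hab, ofReal_integral_eq_lintegral_ofReal]
  · refine setLIntegral_congr_fun measurableSet_Ioc fun x hx => ?_
    have : x ≠ 0 := (ha.trans hx.1).ne'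
    congr 1
    field_simp
  · have := (intervalIntegral.intervalIntegrable_inv (μ := volume) (f := id) (a := a) (b := b)
      (fun x hx h => h0 (by simpa using h ▸ hx)) continuousOn_id)
    exact (intervalIntegrable_iff_integrableOn_Ioc_of_le hab).1 this
  · filter_upwards [ae_restrict_mem measurableSet_Ioc] with x hx
    exact inv_nonneg.2 (ha.trans hx.1).le

lemma setLIntegral_compl_ball_norm_inv_cube {a : ℝ} (ha : 0 < a) :
    ∫⁻ ξ in {ξ : ℂ | a ≤ ‖ξ‖}, ENNReal.ofReal (‖ξ‖⁻¹ ^ 3) =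
      ENNReal.ofReal (2 * Real.pi / a) := by
  have h := setLIntegral_norm_inv_pow (measurableSet_Ici (a := a)) 3
  simp only [Set.mem_Ici] at h
  rw [h, Set.inter_eq_left.2
    (show Set.Ici a ⊆ Set.Ioi 0 from fun x hx => ha.trans_le hx), div_eq_mul_inv,
    ENNReal.ofReal_mul Real.two_pi_pos.le, setLIntegral_congr Ioi_ae_eq_Ici.symm]
  congr 1
  have hi := integral_Ioi_rpow_of_lt (a := -2) (by norm_num) ha
  have hv : a⁻¹ = ∫ t in Set.Ioi a, t ^ (-2 : ℝ) := by
    rw [hi]; norm_num [Real.rpow_neg_one]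
  rw [hv, ofReal_integral_eq_lintegral_ofReal (integrableOn_Ioi_rpow_of_lt (by norm_num) ha)]
  · refine setLIntegral_congr_fun measurableSet_Ioi fun x hx => ?_
    have hx0 : 0 < x := ha.trans hx
    congr 1
    rw [Real.rpow_neg hx0.le]
    norm_num
    field_simp
  · filter_upwards [ae_restrict_mem measurableSet_Ioi] with x hx
    exact Real.rpow_nonneg (ha.trans hx).le _

/-- The singularity `1/|ξ - c|` is uniformly integrable on balls. -/
lemma setLIntegral_ball_norm_sub_inv_le (c x : ℂ) {r : ℝ} (hr : 0 < r) :
    ∫⁻ ξ in Metric.ball x r, ENNReal.ofReal ‖ξ - c‖⁻¹ ≤ ENNReal.ofReal (3 * Real.pi * r) := by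
  -- Off the ball about the singularity the integrand is at most `1/r` on area at most `π r²`; hence
  -- `2π r + π r`.
  have hsub : Metric.ball x r ⊆ Metric.ball c r ∪ Metric.ball x r \ Metric.ball c r := by
    intro y hy; by_cases h : y ∈ Metric.ball c r <;> simp_all
  have h1 : ∫⁻ ξ in Metric.ball c r, ENNReal.ofReal ‖ξ - c‖⁻¹ =
      ENNReal.ofReal (2 * Real.pi * r) := by
    rw [← setLIntegral_ball_norm_inv r, ← lintegral_indicator measurableSet_ball,
      ← lintegral_indicator measurableSet_ball, ← lintegral_add_right_eq_self _ c]
    congr 1 with y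
    simp [Set.indicator, dist_eq_norm]
  have h2 : ∫⁻ ξ in Metric.ball x r \ Metric.ball c r, ENNReal.ofReal ‖ξ - c‖⁻¹ ≤
      ENNReal.ofReal (Real.pi * r) := by
    calc _ ≤ ∫⁻ ξ in Metric.ball x r \ Metric.ball c r, ENNReal.ofReal r⁻¹ := by
          refine setLIntegral_mono (by fun_prop) fun y hy => ENNReal.ofReal_le_ofReal ?_
          have : r ≤ ‖y - c‖ := by simpa [dist_eq_norm] using hy.2
          exact inv_anti₀ hr this
      _ ≤ ∫⁻ ξ in Metric.ball x r, ENNReal.ofReal r⁻¹ := lintegral_mono_set Set.sdiff_subset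
      _ = ENNReal.ofReal (Real.pi * r) := by
          rw [setLIntegral_const, Complex.volume_ball, ← ENNReal.ofReal_pow hr.le,
            ← ENNReal.ofReal_coe_nnreal, ← ENNReal.ofReal_mul (by positivity),
            ← ENNReal.ofReal_mul (by positivity)]
          congr 1
          simp only [NNReal.coe_real_pi]
          field_simp
  calc _ ≤ _ := lintegral_mono_set hsub
    _ ≤ _ := lintegral_union_le _ _ _
    _ ≤ _ := add_le_add h1.le h2
    _ = _ := by rw [← ENNReal.ofReal_add (by positivity) (by positivity)]; congr 1; ring

end Radial

/-! ### Pointwise bounds for the symbol and for the second difference of its reciprocal. -/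

section Symbol

/-- The symbol `|ξ|² + 2 k · ξ` in terms of its zero `-ρ` and of a real parameter `β`. -/
noncomputable def normalSymbol (β : ℝ) (ρ ξ : ℂ) : ℂ :=
  ⟨‖ξ‖ ^ 2 + (ρ * conj ξ).re, β * (ρ * conj ξ).im⟩

lemma normalSymbol_eq (β : ℝ) (ρ ξ : ℂ) : normalSymbol β ρ ξ =
    ((‖ξ‖ ^ 2 + (ρ * conj ξ).re : ℝ) : ℂ) + ((β * (ρ * conj ξ).im : ℝ) : ℂ) * Complex.I := by
  apply Complex.ext <;> simp [normalSymbol, -Complex.ofReal_pow]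

lemma continuous_normalSymbol (β : ℝ) (ρ : ℂ) : Continuous (normalSymbol β ρ) := by
  simp only [funext (normalSymbol_eq β ρ)]
  fun_prop

/-- Both sides are the squared modulus of `conj ξ (ξ + ρ) = |ξ|² + ρ conj ξ`, the symbol at `β = 1`.
-/
lemma norm_sq_mul_norm_add_sq (ρ ξ : ℂ) : (‖ξ‖ * ‖ξ + ρ‖) ^ 2 =
    (‖ξ‖ ^ 2 + (ρ * conj ξ).re) ^ 2 + (ρ * conj ξ).im ^ 2 := by
  rw [mul_pow, Complex.sq_norm, Complex.sq_norm]
  simp [Complex.normSq_apply]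
  ring

lemma sq_norm_normalSymbol (β : ℝ) (ρ ξ : ℂ) : ‖normalSymbol β ρ ξ‖ ^ 2 =
    (‖ξ‖ ^ 2 + (ρ * conj ξ).re) ^ 2 + β ^ 2 * (ρ * conj ξ).im ^ 2 := by
  rw [Complex.sq_norm, Complex.normSq_apply]
  simp only [normalSymbol]
  ring

variable {β : ℝ} {ρ : ℂ}

lemma norm_normalSymbol_le (hβ : |β| ≤ 1) (ξ : ℂ) :
    ‖normalSymbol β ρ ξ‖ ≤ ‖ξ‖ * ‖ξ + ρ‖ := by
  refine le_of_sq_le_sq ?_ (by positivity)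
  rw [sq_norm_normalSymbol, norm_sq_mul_norm_add_sq]
  have : β ^ 2 ≤ 1 := (sq_le_one_iff_abs_le_one β).2 hβ
  nlinarith [sq_nonneg (ρ * conj ξ).im]

lemma le_norm_normalSymbol (hβ : 3 / 5 ≤ |β|) (ξ : ℂ) :
    3 / 5 * (‖ξ‖ * ‖ξ + ρ‖) ≤ ‖normalSymbol β ρ ξ‖ := by
  refine le_of_sq_le_sq ?_ (by positivity)
  rw [sq_norm_normalSymbol, mul_pow, norm_sq_mul_norm_add_sq]
  have : (3 / 5) ^ 2 ≤ β ^ 2 := by rw [← sq_abs β]; gcongr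
  nlinarith [sq_nonneg (ρ * conj ξ).im, sq_nonneg (‖ξ‖ ^ 2 + (ρ * conj ξ).re)]

lemma norm_inv_normalSymbol_le (hβ : 3 / 5 ≤ |β|) (hβ' : |β| ≤ 1) (ξ : ℂ) :
    ‖(normalSymbol β ρ ξ)⁻¹‖ ≤ 5 / 3 * (‖ξ‖⁻¹ * ‖ξ + ρ‖⁻¹) := by
  rw [norm_inv]
  rcases eq_or_ne (‖ξ‖ * ‖ξ + ρ‖) 0 with h | h
  -- At the zeros both inverses are `0` by convention; the upper bound shows that the symbol
  -- vanishes there too.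
  · have := norm_normalSymbol_le (ρ := ρ) hβ' ξ
    rw [h] at this
    rw [le_antisymm this (norm_nonneg _), inv_zero]
    positivity
  · have h0 : 0 < ‖ξ‖ * ‖ξ + ρ‖ := lt_of_le_of_ne (by positivity) h.symm
    calc ‖normalSymbol β ρ ξ‖⁻¹ ≤ (3 / 5 * (‖ξ‖ * ‖ξ + ρ‖))⁻¹ :=
          inv_anti₀ (by positivity) (le_norm_normalSymbol hβ ξ)
      _ = _ := by rw [mul_inv, mul_inv]; norm_num

/-- A partial fraction: `|ρ| ≤ |ξ| + |ξ + ρ|` separates the two singularities at the price of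
`1/|ρ|`. -/
lemma norm_inv_normalSymbol_le_add (hβ : 3 / 5 ≤ |β|) (hβ' : |β| ≤ 1) (hρ : ρ ≠ 0) (ξ : ℂ) :
    ‖(normalSymbol β ρ ξ)⁻¹‖ ≤ 5 / (3 * ‖ρ‖) * (‖ξ‖⁻¹ + ‖ξ + ρ‖⁻¹) := by
  refine (norm_inv_normalSymbol_le hβ hβ' ξ).trans ?_
  have hρ0 : 0 < ‖ρ‖ := norm_pos_iff.2 hρ
  rcases eq_or_ne ξ 0 with h | h
  · simp only [h, norm_zero, inv_zero, zero_mul, mul_zero]; positivity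
  rcases eq_or_ne (ξ + ρ) 0 with h' | h'
  · simp only [h', norm_zero, inv_zero, mul_zero]; positivity
  have h1 : 0 < ‖ξ‖ := norm_pos_iff.2 h
  have h2 : 0 < ‖ξ + ρ‖ := norm_pos_iff.2 h'
  have h3 : ‖ρ‖ ≤ ‖ξ‖ + ‖ξ + ρ‖ := by
    have := norm_sub_le (ξ + ρ) ξ
    rw [add_sub_cancel_left] at this; linarith
  have : ‖ξ‖⁻¹ + ‖ξ + ρ‖⁻¹ = (‖ξ‖ + ‖ξ + ρ‖) * (‖ξ‖⁻¹ * ‖ξ + ρ‖⁻¹) := by field_simp; ring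
  rw [this]
  calc 5 / 3 * (‖ξ‖⁻¹ * ‖ξ + ρ‖⁻¹) = 5 / (3 * ‖ρ‖) * (‖ρ‖ * (‖ξ‖⁻¹ * ‖ξ + ρ‖⁻¹)) := by
        field_simp
    _ ≤ _ := by gcongr

/-- The linear part of the increment of the symbol. -/
noncomputable def symbolSlope (β : ℝ) (ρ ξ h : ℂ) : ℂ :=
  ⟨2 * (ξ * conj h).re + (ρ * conj h).re, β * (ρ * conj h).im⟩

lemma normalSymbol_add (ξ h : ℂ) : normalSymbol β ρ (ξ + h) =
    normalSymbol β ρ ξ + symbolSlope β ρ ξ h + ((‖h‖ ^ 2 : ℝ) : ℂ) := by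
  apply Complex.ext <;>
    simp [normalSymbol, symbolSlope, Complex.sq_norm, Complex.normSq_apply, -Complex.ofReal_pow] <;>
    ring

lemma normalSymbol_sub (ξ h : ℂ) : normalSymbol β ρ (ξ - h) =
    normalSymbol β ρ ξ - symbolSlope β ρ ξ h + ((‖h‖ ^ 2 : ℝ) : ℂ) := by
  apply Complex.ext <;>
    simp [normalSymbol, symbolSlope, Complex.sq_norm, Complex.normSq_apply, -Complex.ofReal_pow] <;>
    ring

lemma norm_symbolSlope_le (hβ : |β| ≤ 1) (ξ h : ℂ) :
    ‖symbolSlope β ρ ξ h‖ ≤ 2 * ‖h‖ * (‖ξ‖ + ‖ξ + ρ‖) := by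
  have h1 : symbolSlope β ρ ξ h =
      ((((2 * ξ + ρ) * conj h).re : ℝ) : ℂ) + ((β * (ρ * conj h).im : ℝ) : ℂ) * Complex.I := by
    apply Complex.ext <;> simp [symbolSlope]; ring
  have h2 : ‖2 * ξ + ρ‖ ≤ ‖ξ‖ + ‖ξ + ρ‖ := by
    rw [show 2 * ξ + ρ = ξ + (ξ + ρ) by ring]; exact norm_add_le _ _
  have h3 : ‖ρ‖ ≤ ‖ξ‖ + ‖ξ + ρ‖ := by
    have := norm_sub_le (ξ + ρ) ξ
    rw [add_sub_cancel_left] at this; linarith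
  have h4 : |((2 * ξ + ρ) * conj h).re| ≤ (‖ξ‖ + ‖ξ + ρ‖) * ‖h‖ := by
    refine (Complex.abs_re_le_norm _).trans ?_
    rw [norm_mul, RCLike.norm_conj]; gcongr
  have h5 : |β * (ρ * conj h).im| ≤ (‖ξ‖ + ‖ξ + ρ‖) * ‖h‖ := by
    rw [abs_mul]
    calc |β| * |(ρ * conj h).im| ≤ 1 * ‖ρ * conj h‖ := by
          gcongr; exact Complex.abs_im_le_norm _
      _ ≤ _ := by rw [one_mul, norm_mul, RCLike.norm_conj]; gcongr
  rw [h1]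
  refine (norm_add_le _ _).trans ?_
  rw [norm_mul, Complex.norm_I, mul_one, Complex.norm_real, Complex.norm_real]
  simp only [Real.norm_eq_abs]
  linarith

/-- The second difference of the reciprocal of the symbol. -/
noncomputable def secondDiff (β : ℝ) (ρ h ξ : ℂ) : ℂ :=
  2 * (normalSymbol β ρ ξ)⁻¹ - (normalSymbol β ρ (ξ - h))⁻¹ - (normalSymbol β ρ (ξ + h))⁻¹

lemma half_norm_le_norm_add {ξ h : ℂ} (hh : 2 * ‖h‖ ≤ ‖ξ‖) : ‖ξ‖ / 2 ≤ ‖ξ + h‖ := by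
  have := norm_sub_le (ξ + h) h
  rw [add_sub_cancel_right] at this; linarith

lemma le_norm_normalSymbol_add (hβ : 3 / 5 ≤ |β|) {ξ h : ℂ}
    (h1 : 2 * ‖h‖ ≤ ‖ξ‖) (h2 : 2 * ‖h‖ ≤ ‖ξ + ρ‖) :
    3 / 20 * (‖ξ‖ * ‖ξ + ρ‖) ≤ ‖normalSymbol β ρ (ξ + h)‖ := by
  have h4 := half_norm_le_norm_add h2
  rw [add_right_comm] at h4
  calc 3 / 20 * (‖ξ‖ * ‖ξ + ρ‖) = 3 / 5 * (‖ξ‖ / 2 * (‖ξ + ρ‖ / 2)) := by ring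
    _ ≤ 3 / 5 * (‖ξ + h‖ * ‖ξ + h + ρ‖) := by
        gcongr; exact half_norm_le_norm_add h1
    _ ≤ _ := le_norm_normalSymbol hβ _

/-- Far from both zeros the three symbols are comparable with `|ξ| |ξ + ρ|`, and the terms linear in
`h` cancel. The parameter `M` stays free because the two regimes take `M = |ρ|` and `M = |h|`. -/
lemma norm_secondDiff_le (hβ : 3 / 5 ≤ |β|) (hβ' : |β| ≤ 1) {ξ h : ℂ} (hh : h ≠ 0)
    (h1 : 2 * ‖h‖ ≤ ‖ξ‖) (h2 : 2 * ‖h‖ ≤ ‖ξ + ρ‖) {M : ℝ} (hM : 0 < M)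
    (hMS : M ≤ ‖ξ‖ + ‖ξ + ρ‖) :
    ‖secondDiff β ρ h ξ‖ ≤ 2800 * ‖h‖ ^ 2 / M * (‖ξ‖⁻¹ ^ 3 + ‖ξ + ρ‖⁻¹ ^ 3) := by
  have hh0 : 0 < ‖h‖ := norm_pos_iff.2 hh
  have hξ : 0 < ‖ξ‖ := by linarith
  have hξρ : 0 < ‖ξ + ρ‖ := by linarith
  have hp0 := le_norm_normalSymbol (ρ := ρ) hβ ξ
  have hp1 := le_norm_normalSymbol_add hβ h1 h2
  have hp2 := le_norm_normalSymbol_add (ξ := ξ) (ρ := ρ) hβ (h := -h) (by simpa) (by simpa)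
  rw [← sub_eq_add_neg] at hp2
  have hup := norm_normalSymbol_le (ρ := ρ) hβ' ξ
  have hsl := norm_symbolSlope_le (ρ := ρ) hβ' ξ h
  have e1 := normalSymbol_add (β := β) (ρ := ρ) ξ h
  have e2 := normalSymbol_sub (β := β) (ρ := ρ) ξ h
  set x := ‖ξ‖
  set y := ‖ξ + ρ‖
  set d := ‖h‖
  have hD : 0 < x * y := by positivity
  have n0 : normalSymbol β ρ ξ ≠ 0 := norm_pos_iff.1 (by linarith)
  have n1 : normalSymbol β ρ (ξ + h) ≠ 0 := norm_pos_iff.1 (by linarith)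
  have n2 : normalSymbol β ρ (ξ - h) ≠ 0 := norm_pos_iff.1 (by linarith)
  -- With `a` the symbol, `s` its slope and `q = |h|²`, the neighbours are `a ∓ s + q`; over the
  -- common denominator the numerator reduces to `2aq + 2q² - 2s²`, quadratic in `h`.
  have key : secondDiff β ρ h ξ =
      (2 * normalSymbol β ρ ξ * ((d ^ 2 : ℝ) : ℂ) + 2 * ((d ^ 2 : ℝ) : ℂ) ^ 2 -
        2 * symbolSlope β ρ ξ h ^ 2) /
      (normalSymbol β ρ ξ * normalSymbol β ρ (ξ - h) * normalSymbol β ρ (ξ + h)) := by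
    rw [eq_div_iff (by positivity), secondDiff]
    have : ∀ a b c : ℂ, a ≠ 0 → b ≠ 0 → c ≠ 0 →
        (2 * a⁻¹ - b⁻¹ - c⁻¹) * (a * b * c) = 2 * b * c - a * c - a * b := by
      intro a b c ha hb hc; field_simp
    rw [this _ _ _ n0 n2 n1, e1, e2]
    ring
  have hxy : x * y ≤ (x + y) ^ 2 / 4 := by nlinarith [sq_nonneg (x - y)]
  have hd : d ≤ (x + y) / 4 := by linarith
  have num : ‖2 * normalSymbol β ρ ξ * ((d ^ 2 : ℝ) : ℂ) + 2 * ((d ^ 2 : ℝ) : ℂ) ^ 2 -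
        2 * symbolSlope β ρ ξ h ^ 2‖ ≤ 9 * d ^ 2 * (x + y) ^ 2 := by
    have t1 : ‖2 * normalSymbol β ρ ξ * ((d ^ 2 : ℝ) : ℂ)‖ ≤ 2 * ((x + y) ^ 2 / 4) * d ^ 2 := by
      rw [norm_mul, norm_mul, Complex.norm_real, Real.norm_of_nonneg (by positivity)]
      norm_num
      gcongr
      exact hup.trans hxy
    have t2 : ‖2 * ((d ^ 2 : ℝ) : ℂ) ^ 2‖ ≤ 2 * (((x + y) / 4) ^ 2 * d ^ 2) := by
      rw [norm_mul, norm_pow, Complex.norm_real, Real.norm_of_nonneg (by positivity), sq (d ^ 2)]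
      norm_num
      gcongr
    have t3 : ‖2 * symbolSlope β ρ ξ h ^ 2‖ ≤ 2 * (2 * d * (x + y)) ^ 2 := by
      rw [norm_mul, norm_pow]
      norm_num
      gcongr
    calc _ ≤ _ := norm_sub_le _ _
      _ ≤ _ := add_le_add (norm_add_le _ _) le_rfl
      _ ≤ _ := add_le_add (add_le_add t1 t2) t3
      _ ≤ _ := by nlinarith [show 0 ≤ d ^ 2 * (x + y) ^ 2 by positivity]
  have den : 27 / 2000 * (x * y) ^ 3 ≤
      ‖normalSymbol β ρ ξ * normalSymbol β ρ (ξ - h) * normalSymbol β ρ (ξ + h)‖ := by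
    rw [norm_mul, norm_mul]
    calc 27 / 2000 * (x * y) ^ 3 =
          (3 / 5 * (x * y)) * (3 / 20 * (x * y)) * (3 / 20 * (x * y)) := by ring
      _ ≤ _ := by gcongr
  have cube : (x⁻¹ + y⁻¹) ^ 3 ≤ 4 * (x⁻¹ ^ 3 + y⁻¹ ^ 3) := by
    have hx' : 0 < x⁻¹ := by positivity
    have hy' : 0 < y⁻¹ := by positivity
    nlinarith [mul_nonneg (add_pos hx' hy').le (sq_nonneg (x⁻¹ - y⁻¹))]
  rw [key, norm_div]
  calc _ ≤ (9 * d ^ 2 * (x + y) ^ 2) / (27 / 2000 * (x * y) ^ 3) := by gcongr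
    -- Replacing `M` by `x + y` completes the cube `((x + y)/(xy))³ = (1/x + 1/y)³`.
    _ = 2000 / 3 * d ^ 2 / M * (M * (x + y) ^ 2 / (x * y) ^ 3) := by field_simp; norm_num
    _ ≤ 2000 / 3 * d ^ 2 / M * ((x + y) * (x + y) ^ 2 / (x * y) ^ 3) := by gcongr
    _ = 2000 / 3 * d ^ 2 / M * (x⁻¹ + y⁻¹) ^ 3 := by
        congr 1
        have : x⁻¹ + y⁻¹ = (x + y) / (x * y) := by field_simp; ring
        rw [this, div_pow]; ring
    _ ≤ 2000 / 3 * d ^ 2 / M * (4 * (x⁻¹ ^ 3 + y⁻¹ ^ 3)) := by gcongr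
    _ ≤ 2800 * d ^ 2 / M * (x⁻¹ ^ 3 + y⁻¹ ^ 3) := by
        have : 0 ≤ d ^ 2 / M * (x⁻¹ ^ 3 + y⁻¹ ^ 3) := by positivity
        calc _ = 8000 / 3 * (d ^ 2 / M * (x⁻¹ ^ 3 + y⁻¹ ^ 3)) := by ring
          _ ≤ 2800 * (d ^ 2 / M * (x⁻¹ ^ 3 + y⁻¹ ^ 3)) := by gcongr; norm_num
          _ = _ := by ring

end Symbol

/-! ### Integral bounds for the reciprocal symbol and its second difference. -/

section Bounds

variable {β : ℝ} {ρ : ℂ}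

lemma measurable_inv_normalSymbol : Measurable fun ξ => (normalSymbol β ρ ξ)⁻¹ :=
  (continuous_normalSymbol β ρ).measurable.inv

lemma measurable_secondDiff (h : ℂ) : Measurable (secondDiff β ρ h) := by
  have := measurable_inv_normalSymbol (β := β) (ρ := ρ)
  have h1 := this.comp (measurable_id.sub_const h)
  have h2 := this.comp (measurable_id.add_const h)
  exact ((this.const_mul 2).sub h1).sub h2

lemma setLIntegral_ball_comp_add_right (g : ℂ → ℝ≥0∞) (x c : ℂ) (r : ℝ) :
    ∫⁻ ξ in Metric.ball x r, g (ξ + c) = ∫⁻ ξ in Metric.ball (x + c) r, g ξ := by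
  rw [← (measurePreserving_add_right volume c).setLIntegral_comp_preimage_emb
    (measurableEmbedding_addRight c) g (Metric.ball (x + c) r)]
  congr 2
  ext; simp [dist_eq_norm]

lemma setLIntegral_ball_inv_normalSymbol_le (hβ : 3 / 5 ≤ |β|) (hβ' : |β| ≤ 1) (hρ : ρ ≠ 0)
    (x : ℂ) {r : ℝ} (hr : 0 < r) :
    ∫⁻ ξ in Metric.ball x r, ‖(normalSymbol β ρ ξ)⁻¹‖ₑ ≤
      ENNReal.ofReal (10 * Real.pi * r / ‖ρ‖) := by
  have hρ0 : 0 < ‖ρ‖ := norm_pos_iff.2 hρ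
  calc _ ≤ ∫⁻ ξ in Metric.ball x r, ENNReal.ofReal (5 / (3 * ‖ρ‖)) *
        (ENNReal.ofReal ‖ξ - 0‖⁻¹ + ENNReal.ofReal ‖ξ - (-ρ)‖⁻¹) := by
        refine lintegral_mono fun ξ => ?_
        simp only
        rw [← ofReal_norm, ← ENNReal.ofReal_add (by positivity) (by positivity),
          ← ENNReal.ofReal_mul (by positivity), sub_zero, sub_neg_eq_add]
        exact ENNReal.ofReal_le_ofReal (norm_inv_normalSymbol_le_add hβ hβ' hρ ξ)
    _ ≤ ENNReal.ofReal (5 / (3 * ‖ρ‖)) *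
        (ENNReal.ofReal (3 * Real.pi * r) + ENNReal.ofReal (3 * Real.pi * r)) := by
        rw [lintegral_const_mul _ (by fun_prop), lintegral_add_left (by fun_prop)]
        gcongr <;> exact setLIntegral_ball_norm_sub_inv_le _ _ hr
    _ = _ := by
        rw [← ENNReal.ofReal_add (by positivity) (by positivity),
          ← ENNReal.ofReal_mul (by positivity)]
        congr 1
        field_simp
        ring

lemma setLIntegral_annulus_inv_normalSymbol_le (hβ : 3 / 5 ≤ |β|) (hβ' : |β| ≤ 1)
    {a b : ℝ} (ha : 0 < a) (hab : a ≤ b) (hρa : 2 * ‖ρ‖ ≤ a) :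
    ∫⁻ ξ in {ξ : ℂ | ‖ξ‖ ∈ Set.Ioc a b}, ‖(normalSymbol β ρ ξ)⁻¹‖ₑ ≤
      ENNReal.ofReal (20 / 3 * Real.pi * Real.log (b / a)) := by
  calc _ ≤ ∫⁻ ξ in {ξ : ℂ | ‖ξ‖ ∈ Set.Ioc a b},
        ENNReal.ofReal (10 / 3) * ENNReal.ofReal (‖ξ‖⁻¹ ^ 2) := by
        refine setLIntegral_mono (by fun_prop) fun ξ hξ => ?_
        have hξ1 : a < ‖ξ‖ := hξ.1
        have hξ0 : 0 < ‖ξ‖ := ha.trans hξ1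
        rw [← ofReal_norm, ← ENNReal.ofReal_mul (by positivity)]
        refine ENNReal.ofReal_le_ofReal ((norm_inv_normalSymbol_le hβ hβ' ξ).trans ?_)
        have h1 : ‖ξ + ρ‖⁻¹ ≤ (‖ξ‖ / 2)⁻¹ :=
          inv_anti₀ (by positivity) (half_norm_le_norm_add (by linarith))
        calc _ ≤ 5 / 3 * (‖ξ‖⁻¹ * (‖ξ‖ / 2)⁻¹) := by gcongr
          _ = _ := by field_simp; norm_num
    _ = _ := by
        rw [lintegral_const_mul _ (by fun_prop), setLIntegral_annulus_norm_inv_sq ha hab,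
          ← ENNReal.ofReal_mul (by positivity)]
        congr 1
        ring

lemma setLIntegral_ball_inv_normalSymbol_le_log (hβ : 3 / 5 ≤ |β|) (hβ' : |β| ≤ 1) (hρ : ρ ≠ 0)
    {L : ℝ} (hL : 2 * ‖ρ‖ ≤ L) :
    ∫⁻ ξ in Metric.ball 0 L, ‖(normalSymbol β ρ ξ)⁻¹‖ₑ ≤
      ENNReal.ofReal (30 * Real.pi + 20 / 3 * Real.pi * Real.log (L / (2 * ‖ρ‖))) := by
  have hρ0 : 0 < ‖ρ‖ := norm_pos_iff.2 hρ
  -- The annulus must start at `2|ρ|`, where `|ξ + ρ| ≥ |ξ|/2` holds; the disc of radius `3|ρ|`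
  -- overlaps it, so the circle `|ξ| = 2|ρ|` is covered.
  have hsub : Metric.ball (0 : ℂ) L ⊆
      Metric.ball 0 (3 * ‖ρ‖) ∪ {ξ : ℂ | ‖ξ‖ ∈ Set.Ioc (2 * ‖ρ‖) L} := by
    intro ξ hξ
    have hξ' : ‖ξ‖ < L := by simpa using hξ
    rcases lt_or_ge ‖ξ‖ (3 * ‖ρ‖) with h | h
    · left; simpa using h
    · right; exact ⟨by linarith, hξ'.le⟩
  have hlog : 0 ≤ Real.log (L / (2 * ‖ρ‖)) :=
    Real.log_nonneg ((one_le_div (by positivity)).2 hL)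
  calc _ ≤ _ := lintegral_mono_set hsub
    _ ≤ _ := lintegral_union_le _ _ _
    _ ≤ _ := add_le_add
        (setLIntegral_ball_inv_normalSymbol_le hβ hβ' hρ 0 (r := 3 * ‖ρ‖) (by positivity))
        (setLIntegral_annulus_inv_normalSymbol_le hβ hβ' (by positivity) hL le_rfl)
    _ = _ := by
        rw [← ENNReal.ofReal_add (by positivity) (by positivity)]
        congr 2
        field_simp
        norm_num

/-- No cancellation is used: the weights `2, 1, 1` add up to `4`, and each translation only moves
the centre of the ball. -/
lemma setLIntegral_ball_secondDiff_le {h x : ℂ} {r : ℝ} {B : ℝ≥0∞}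
    (hB : ∀ c : ℂ, ‖c‖ ≤ ‖h‖ →
      ∫⁻ ξ in Metric.ball (x + c) r, ‖(normalSymbol β ρ ξ)⁻¹‖ₑ ≤ B) :
    ∫⁻ ξ in Metric.ball x r, ‖secondDiff β ρ h ξ‖ₑ ≤ 4 * B := by
  have hm := measurable_inv_normalSymbol (β := β) (ρ := ρ)
  have hm1 : Measurable fun ξ => ‖(normalSymbol β ρ (ξ + -h))⁻¹‖ₑ :=
    (hm.comp (measurable_id.add_const _)).enorm
  calc _ ≤ ∫⁻ ξ in Metric.ball x r, (2 * ‖(normalSymbol β ρ ξ)⁻¹‖ₑ +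
          ‖(normalSymbol β ρ (ξ + -h))⁻¹‖ₑ + ‖(normalSymbol β ρ (ξ + h))⁻¹‖ₑ) := by
        refine lintegral_mono fun ξ => ?_
        simp only [secondDiff]
        refine (enorm_sub_le).trans (add_le_add ((enorm_sub_le).trans (add_le_add ?_ ?_)) le_rfl)
        · rw [enorm_mul]
          gcongr
          rw [← ofReal_norm]; simp
        · rw [← sub_eq_add_neg]
    _ = 2 * (∫⁻ ξ in Metric.ball (x + 0) r, ‖(normalSymbol β ρ ξ)⁻¹‖ₑ) +
        (∫⁻ ξ in Metric.ball (x + -h) r, ‖(normalSymbol β ρ ξ)⁻¹‖ₑ) +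
        ∫⁻ ξ in Metric.ball (x + h) r, ‖(normalSymbol β ρ ξ)⁻¹‖ₑ := by
        rw [lintegral_add_left (f := fun ξ => 2 * ‖(normalSymbol β ρ ξ)⁻¹‖ₑ +
            ‖(normalSymbol β ρ (ξ + -h))⁻¹‖ₑ) ((hm.enorm.const_mul 2).add hm1),
          lintegral_add_left (hm.enorm.const_mul 2), lintegral_const_mul _ hm.enorm, add_zero,
          setLIntegral_ball_comp_add_right (fun ξ => ‖(normalSymbol β ρ ξ)⁻¹‖ₑ),
          setLIntegral_ball_comp_add_right (fun ξ => ‖(normalSymbol β ρ ξ)⁻¹‖ₑ)]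
    _ ≤ 2 * B + B + B := by
        gcongr
        · exact hB 0 (by simp)
        · exact hB (-h) (by simp)
        · exact hB h le_rfl
    _ = _ := by ring

lemma setLIntegral_far_secondDiff_le (hβ : 3 / 5 ≤ |β|) (hβ' : |β| ≤ 1) {h : ℂ} (hh : h ≠ 0)
    {M : ℝ} (hM : 0 < M)
    (hMS : ∀ ξ : ℂ, 2 * ‖h‖ ≤ ‖ξ‖ → 2 * ‖h‖ ≤ ‖ξ + ρ‖ → M ≤ ‖ξ‖ + ‖ξ + ρ‖) :
    ∫⁻ ξ in {ξ : ℂ | 2 * ‖h‖ ≤ ‖ξ‖ ∧ 2 * ‖h‖ ≤ ‖ξ + ρ‖}, ‖secondDiff β ρ h ξ‖ₑ ≤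
      ENNReal.ofReal (5600 * Real.pi * ‖h‖ / M) := by
  have hh0 : 0 < ‖h‖ := norm_pos_iff.2 hh
  set A : Set ℂ := {ξ : ℂ | 2 * ‖h‖ ≤ ‖ξ‖}
  have hI : ∫⁻ ξ in A, ENNReal.ofReal (‖ξ‖⁻¹ ^ 3) = ENNReal.ofReal (2 * Real.pi / (2 * ‖h‖)) :=
    setLIntegral_compl_ball_norm_inv_cube (by positivity)
  have hI' : ∫⁻ ξ in {ξ : ℂ | 2 * ‖h‖ ≤ ‖ξ + ρ‖}, ENNReal.ofReal (‖ξ + ρ‖⁻¹ ^ 3) =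
      ENNReal.ofReal (2 * Real.pi / (2 * ‖h‖)) := by
    rw [← hI, ← (measurePreserving_add_right volume ρ).setLIntegral_comp_preimage_emb
      (measurableEmbedding_addRight ρ) (fun ξ => ENNReal.ofReal (‖ξ‖⁻¹ ^ 3)) A]
    rfl
  calc _ ≤ ∫⁻ ξ in {ξ : ℂ | 2 * ‖h‖ ≤ ‖ξ‖ ∧ 2 * ‖h‖ ≤ ‖ξ + ρ‖},
        ENNReal.ofReal (2800 * ‖h‖ ^ 2 / M) *
          (ENNReal.ofReal (‖ξ‖⁻¹ ^ 3) + ENNReal.ofReal (‖ξ + ρ‖⁻¹ ^ 3)) := by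
        refine setLIntegral_mono (by fun_prop) fun ξ hξ => ?_
        rw [← ofReal_norm, ← ENNReal.ofReal_add (by positivity) (by positivity),
          ← ENNReal.ofReal_mul (by positivity)]
        exact ENNReal.ofReal_le_ofReal
          (norm_secondDiff_le hβ hβ' hh hξ.1 hξ.2 hM (hMS ξ hξ.1 hξ.2))
    _ ≤ ENNReal.ofReal (2800 * ‖h‖ ^ 2 / M) * (ENNReal.ofReal (2 * Real.pi / (2 * ‖h‖)) +
        ENNReal.ofReal (2 * Real.pi / (2 * ‖h‖))) := by
        rw [lintegral_const_mul _ (by fun_prop), lintegral_add_left (by fun_prop)]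
        gcongr
        · rw [← hI]; exact lintegral_mono_set fun ξ hξ => hξ.1
        · rw [← hI']; exact lintegral_mono_set fun ξ hξ => hξ.2
    _ = _ := by
        rw [← ENNReal.ofReal_add (by positivity) (by positivity),
          ← ENNReal.ofReal_mul (by positivity)]
        congr 1
        field_simp
        norm_num

/-- The plane is covered by the balls of radius `2|h|` about the two zeros, costing `4B` each, and
the far region. `M` and `B` are chosen later according to the regime. -/
lemma lintegral_secondDiff_le (hβ : 3 / 5 ≤ |β|) (hβ' : |β| ≤ 1) {h : ℂ} (hh : h ≠ 0)
    {M B : ℝ} (hM : 0 < M) (hB0 : 0 ≤ B)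
    (hMS : ∀ ξ : ℂ, 2 * ‖h‖ ≤ ‖ξ‖ → 2 * ‖h‖ ≤ ‖ξ + ρ‖ → M ≤ ‖ξ‖ + ‖ξ + ρ‖)
    (hB : ∀ c : ℂ, ‖c‖ ≤ ‖ρ‖ + ‖h‖ →
      ∫⁻ ξ in Metric.ball c (2 * ‖h‖), ‖(normalSymbol β ρ ξ)⁻¹‖ₑ ≤ ENNReal.ofReal B) :
    ∫⁻ ξ, ‖secondDiff β ρ h ξ‖ₑ ≤ ENNReal.ofReal (8 * B + 5600 * Real.pi * ‖h‖ / M) := by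
  have hcover : (Set.univ : Set ℂ) ⊆ (Metric.ball 0 (2 * ‖h‖) ∪ Metric.ball (-ρ) (2 * ‖h‖)) ∪
      {ξ : ℂ | 2 * ‖h‖ ≤ ‖ξ‖ ∧ 2 * ‖h‖ ≤ ‖ξ + ρ‖} := by
    intro ξ _
    by_cases h1 : 2 * ‖h‖ ≤ ‖ξ‖
    · by_cases h2 : 2 * ‖h‖ ≤ ‖ξ + ρ‖
      · exact Or.inr ⟨h1, h2⟩
      · exact Or.inl (Or.inr (by simpa [dist_eq_norm] using h2))
    · exact Or.inl (Or.inl (by simpa using h1))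
  have n1 : ∫⁻ ξ in Metric.ball 0 (2 * ‖h‖), ‖secondDiff β ρ h ξ‖ₑ ≤ 4 * ENNReal.ofReal B :=
    setLIntegral_ball_secondDiff_le fun c hc =>
      hB _ (by rw [zero_add]; linarith [norm_nonneg ρ])
  have n2 : ∫⁻ ξ in Metric.ball (-ρ) (2 * ‖h‖), ‖secondDiff β ρ h ξ‖ₑ ≤ 4 * ENNReal.ofReal B :=
    setLIntegral_ball_secondDiff_le fun c hc =>
      hB _ ((norm_add_le _ _).trans (by rw [norm_neg]; linarith))
  calc _ ≤ _ := by rw [← setLIntegral_univ]; exact lintegral_mono_set hcover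
    _ ≤ _ := lintegral_union_le _ _ _
    _ ≤ (4 * ENNReal.ofReal B + 4 * ENNReal.ofReal B) +
        ENNReal.ofReal (5600 * Real.pi * ‖h‖ / M) :=
        add_le_add ((lintegral_union_le _ _ _).trans (add_le_add n1 n2))
          (setLIntegral_far_secondDiff_le hβ hβ' hh hM hMS)
    _ = _ := by
        rw [ENNReal.ofReal_add (by positivity) (by positivity),
          ENNReal.ofReal_mul (by norm_num), ENNReal.ofReal_ofNat]
        ring

lemma lintegral_secondDiff_le_div (hβ : 3 / 5 ≤ |β|) (hβ' : |β| ≤ 1) (hρ : ρ ≠ 0) {h : ℂ}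
    (hh : h ≠ 0) :
    ∫⁻ ξ, ‖secondDiff β ρ h ξ‖ₑ ≤ ENNReal.ofReal (5760 * Real.pi * ‖h‖ / ‖ρ‖) := by
  have hh0 : 0 < ‖h‖ := norm_pos_iff.2 hh
  have hρ0 : 0 < ‖ρ‖ := norm_pos_iff.2 hρ
  refine (lintegral_secondDiff_le hβ hβ' hh (B := 10 * Real.pi * (2 * ‖h‖) / ‖ρ‖) hρ0
    (by positivity) (fun ξ _ _ => ?_) fun c _ =>
      setLIntegral_ball_inv_normalSymbol_le hβ hβ' hρ c (by positivity)).trans_eq ?_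
  · have := norm_sub_le (ξ + ρ) ξ
    rw [add_sub_cancel_left] at this; linarith
  · congr 1; ring

lemma lintegral_secondDiff_le_log (hβ : 3 / 5 ≤ |β|) (hβ' : |β| ≤ 1) (hρ : ρ ≠ 0) {h : ℂ}
    (hh : h ≠ 0) (hρh : ‖ρ‖ ≤ ‖h‖) :
    ∫⁻ ξ, ‖secondDiff β ρ h ξ‖ₑ ≤
      ENNReal.ofReal (5840 * Real.pi + 160 / 3 * Real.pi * Real.log (2 * ‖h‖ / ‖ρ‖)) := by
  have hh0 : 0 < ‖h‖ := norm_pos_iff.2 hh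
  have hρ0 : 0 < ‖ρ‖ := norm_pos_iff.2 hρ
  have hlog : 0 ≤ Real.log (2 * ‖h‖ / ‖ρ‖) :=
    Real.log_nonneg ((one_le_div (by positivity)).2 (by linarith))
  refine (lintegral_secondDiff_le hβ hβ' hh hh0
    (B := 30 * Real.pi + 20 / 3 * Real.pi * Real.log (2 * ‖h‖ / ‖ρ‖)) (by positivity)
    (fun ξ _ _ => by linarith) fun c hc => ?_).trans_eq ?_
  -- The centre satisfies `|c| ≤ |ρ| + |h| ≤ 2|h|`, so each ball lies in the disc of radius `4|h|`
  -- about `0`.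
  · refine (lintegral_mono_set (Metric.ball_subset_ball' (y := 0) (ε₂ := 4 * ‖h‖) ?_)).trans
      ((setLIntegral_ball_inv_normalSymbol_le_log hβ hβ' hρ (by linarith)).trans_eq ?_)
    · rw [dist_zero_right]; linarith
    · rw [show 4 * ‖h‖ / (2 * ‖ρ‖) = 2 * ‖h‖ / ‖ρ‖ by field_simp; norm_num]
  · congr 1
    field_simp
    ring

end Bounds

/-! ### Half-period translation and convergence of the truncated integrals. -/

section Convergence

/-- The plane wave `e^{i ξ · x}`. -/
noncomputable def planeWave (z ξ : ℂ) : ℂ :=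
  Complex.exp (Complex.I * ((ξ.re * z.re + ξ.im * z.im : ℝ) : ℂ))

lemma norm_planeWave (z ξ : ℂ) : ‖planeWave z ξ‖ = 1 := by
  rw [planeWave, mul_comm, Complex.norm_exp_ofReal_mul_I]

lemma continuous_planeWave (z : ℂ) : Continuous (planeWave z) := by
  unfold planeWave; fun_prop

/-- The shift which changes the sign of the plane wave. -/
noncomputable def halfPeriod (z : ℂ) : ℂ := ((Real.pi / ‖z‖ ^ 2 : ℝ) : ℂ) * z

lemma norm_halfPeriod (z : ℂ) : ‖halfPeriod z‖ = Real.pi / ‖z‖ := by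
  rcases eq_or_ne z 0 with rfl | hz
  · simp [halfPeriod]
  · have : 0 < ‖z‖ := norm_pos_iff.2 hz
    rw [halfPeriod, norm_mul, Complex.norm_real, Real.norm_of_nonneg (by positivity)]
    field_simp

lemma halfPeriod_dot {z : ℂ} (hz : z ≠ 0) :
    (halfPeriod z).re * z.re + (halfPeriod z).im * z.im = Real.pi := by
  have h0 : ‖z‖ ^ 2 ≠ 0 := by simpa using hz
  have h1 : ‖z‖ ^ 2 = z.re * z.re + z.im * z.im := by
    rw [Complex.sq_norm, Complex.normSq_apply]
  rw [halfPeriod, Complex.re_ofReal_mul, Complex.im_ofReal_mul]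
  calc _ = Real.pi / ‖z‖ ^ 2 * (z.re * z.re + z.im * z.im) := by ring
    _ = Real.pi := by rw [← h1]; field_simp

lemma planeWave_add_halfPeriod {z : ℂ} (hz : z ≠ 0) (ξ : ℂ) :
    planeWave z (ξ + halfPeriod z) = -planeWave z ξ := by
  have : ((ξ + halfPeriod z).re * z.re + (ξ + halfPeriod z).im * z.im : ℝ) =
      (ξ.re * z.re + ξ.im * z.im) + Real.pi := by
    rw [← halfPeriod_dot hz, Complex.add_re, Complex.add_im]; ring
  rw [planeWave, planeWave, this, Complex.ofReal_add, mul_add, Complex.exp_add,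
    mul_comm Complex.I (Real.pi : ℂ), Complex.exp_pi_mul_I, mul_neg_one]

lemma planeWave_add_neg_halfPeriod {z : ℂ} (hz : z ≠ 0) (ξ : ℂ) :
    planeWave z (ξ + -halfPeriod z) = -planeWave z ξ := by
  have := planeWave_add_halfPeriod hz (ξ + -halfPeriod z)
  rw [neg_add_cancel_right] at this
  rw [this, neg_neg]

variable {β : ℝ} {ρ : ℂ}

lemma integrableOn_ball_inv_normalSymbol (hβ : 3 / 5 ≤ |β|) (hβ' : |β| ≤ 1) (hρ : ρ ≠ 0)
    (x : ℂ) (r : ℝ) :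
    IntegrableOn (fun ξ => (normalSymbol β ρ ξ)⁻¹) (Metric.ball x r) := by
  rcases le_or_gt r 0 with hr | hr
  · rw [Metric.ball_eq_empty.2 hr]; exact integrableOn_empty
  · exact ⟨measurable_inv_normalSymbol.aestronglyMeasurable,
      (setLIntegral_ball_inv_normalSymbol_le hβ hβ' hρ x hr).trans_lt ENNReal.ofReal_lt_top⟩

lemma integrable_planeWave_mul {μ : Measure ℂ} {f : ℂ → ℂ} (hf : Integrable f μ) (z : ℂ) :
    Integrable (fun ξ => planeWave z ξ * f ξ) μ :=
  hf.bdd_mul (c := 1) (continuous_planeWave z).aestronglyMeasurable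
    (Eventually.of_forall fun ξ => (norm_planeWave z ξ).le)

lemma integral_ball_planeWave_mul_shift {z c : ℂ} (hc : ∀ ξ, planeWave z (ξ + c) = -planeWave z ξ)
    (f : ℂ → ℂ) (R : ℝ) :
    ∫ ξ in Metric.ball 0 R, planeWave z ξ * f (ξ + c) =
      -∫ ξ in Metric.ball c R, planeWave z ξ * f ξ := by
  rw [← (measurePreserving_add_right volume c).setIntegral_preimage_emb
    (measurableEmbedding_addRight c) _ (Metric.ball c R), ← integral_neg]
  have : (fun x => x + c) ⁻¹' Metric.ball c R = Metric.ball 0 R := by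
    ext; simp [dist_eq_norm]
  rw [this]
  simp only [hc, neg_mul, neg_neg]

/-- Both discs contain the disc of radius `R - |c|` about `0` and exceed it only inside the annulus,
hence `2B`. The extra `-1` lets the half-open interval include the circle `|ξ| = R - |c|`. -/
lemma norm_integral_ball_sub_le {f : ℂ → ℂ} (hf : ∀ x r, IntegrableOn f (Metric.ball x r))
    (c : ℂ) (R : ℝ) {B : ℝ} (hB0 : 0 ≤ B)
    (hB : ∫⁻ ξ in {ξ : ℂ | ‖ξ‖ ∈ Set.Ioc (R - ‖c‖ - 1) (R + ‖c‖)}, ‖f ξ‖ₑ ≤ ENNReal.ofReal B) :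
    ‖(∫ ξ in Metric.ball 0 R, f ξ) - ∫ ξ in Metric.ball c R, f ξ‖ ≤ 2 * B := by
  have key : ∀ x : ℂ, ‖x‖ ≤ ‖c‖ →
      ‖(∫ ξ in Metric.ball x R, f ξ) - ∫ ξ in Metric.ball 0 (R - ‖c‖), f ξ‖ ≤ B := by
    intro x hx
    have hsub : Metric.ball (0 : ℂ) (R - ‖c‖) ⊆ Metric.ball x R :=
      Metric.ball_subset_ball' (by rw [dist_zero_left]; linarith)
    rw [← setIntegral_sdiff measurableSet_ball (hf x R) hsub]
    refine (norm_integral_le_lintegral_norm _).trans (ENNReal.toReal_le_of_le_ofReal hB0 ?_)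
    simp only [ofReal_norm]
    refine (lintegral_mono_set fun ξ hξ => ?_).trans hB
    have h1 : ‖ξ - x‖ < R := by simpa [dist_eq_norm] using hξ.1
    have h2 : R - ‖c‖ ≤ ‖ξ‖ := by simpa using hξ.2
    have h3 := norm_add_le (ξ - x) x
    rw [sub_add_cancel] at h3
    exact ⟨by linarith, by linarith⟩
  have h1 := key 0 (by simp)
  have h2 := key c le_rfl
  calc _ = ‖((∫ ξ in Metric.ball 0 R, f ξ) - ∫ ξ in Metric.ball 0 (R - ‖c‖), f ξ) -
      ((∫ ξ in Metric.ball c R, f ξ) - ∫ ξ in Metric.ball 0 (R - ‖c‖), f ξ)‖ := by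
        congr 1; ring
    _ ≤ _ := norm_sub_le _ _
    _ ≤ _ := by linarith

/-- The discs differ within an annulus of bounded width, where `|ξ|⁻²` integrates to a multiple of
the logarithm of a radius ratio tending to `1`. -/
lemma tendsto_integral_ball_sub (hβ : 3 / 5 ≤ |β|) (hβ' : |β| ≤ 1) (hρ : ρ ≠ 0) (z c : ℂ) :
    Tendsto (fun R : ℝ => (∫ ξ in Metric.ball 0 R, planeWave z ξ * (normalSymbol β ρ ξ)⁻¹) -
      ∫ ξ in Metric.ball c R, planeWave z ξ * (normalSymbol β ρ ξ)⁻¹) atTop (𝓝 0) := by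
  have hlim : Tendsto (fun R : ℝ => 2 * (20 / 3 * Real.pi *
      Real.log ((R + ‖c‖) / (R - ‖c‖ - 1)))) atTop (𝓝 0) := by
    have h1 : Tendsto (fun R : ℝ => 1 + (2 * ‖c‖ + 1) / (R - ‖c‖ - 1)) atTop (𝓝 (1 + 0)) := by
      refine tendsto_const_nhds.add (tendsto_const_nhds.div_atTop ?_)
      exact tendsto_atTop_add_const_right _ (-1) (tendsto_atTop_add_const_right _ (-‖c‖) tendsto_id)
    have h2 : Tendsto (fun R : ℝ => (R + ‖c‖) / (R - ‖c‖ - 1)) atTop (𝓝 1) := by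
      rw [add_zero] at h1
      refine h1.congr' ?_
      filter_upwards [eventually_gt_atTop (‖c‖ + 1)] with R hR
      have : R - ‖c‖ - 1 ≠ 0 := by linarith
      field_simp
      ring
    have h3 := ((Real.continuousAt_log one_ne_zero).tendsto.comp h2).const_mul
      (2 * (20 / 3 * Real.pi))
    rw [Real.log_one, mul_zero] at h3
    exact h3.congr fun R => by simp only [Function.comp]; ring
  refine squeeze_zero_norm' ?_ hlim
  filter_upwards [eventually_gt_atTop (‖c‖ + 1 + 2 * ‖ρ‖)] with R hR
  have hρ0 : 0 < ‖ρ‖ := norm_pos_iff.2 hρ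
  have hle : R - ‖c‖ - 1 ≤ R + ‖c‖ := by linarith [norm_nonneg c]
  have ha : 0 < R - ‖c‖ - 1 := by linarith
  refine norm_integral_ball_sub_le
    (fun x r => integrable_planeWave_mul (integrableOn_ball_inv_normalSymbol hβ hβ' hρ x r) z) c R ?_ ?_
  · have := Real.log_nonneg ((one_le_div ha).2 hle)
    positivity
  · refine le_trans (le_of_eq ?_)
      (setLIntegral_annulus_inv_normalSymbol_le (β := β) (ρ := ρ) hβ hβ' ha hle (by linarith))
    refine lintegral_congr fun ξ => ?_
    rw [enorm_mul, ← ofReal_norm (planeWave z ξ), norm_planeWave, ENNReal.ofReal_one, one_mul]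

/-- The sign change under `±halfPeriod z` turns each translated term of the second difference into a
further copy of the integral, but over a translated disc. -/
lemma four_mul_integral_ball (hβ : 3 / 5 ≤ |β|) (hβ' : |β| ≤ 1) (hρ : ρ ≠ 0) {z : ℂ} (hz : z ≠ 0)
    (R : ℝ) :
    4 * ∫ ξ in Metric.ball 0 R, planeWave z ξ * (normalSymbol β ρ ξ)⁻¹ =
      (∫ ξ in Metric.ball 0 R, planeWave z ξ * secondDiff β ρ (halfPeriod z) ξ) +
      ((∫ ξ in Metric.ball 0 R, planeWave z ξ * (normalSymbol β ρ ξ)⁻¹) -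
        ∫ ξ in Metric.ball (halfPeriod z) R, planeWave z ξ * (normalSymbol β ρ ξ)⁻¹) +
      ((∫ ξ in Metric.ball 0 R, planeWave z ξ * (normalSymbol β ρ ξ)⁻¹) -
        ∫ ξ in Metric.ball (-halfPeriod z) R, planeWave z ξ * (normalSymbol β ρ ξ)⁻¹) := by
  set f : ℂ → ℂ := fun ξ => (normalSymbol β ρ ξ)⁻¹ with hf
  have hint : ∀ x r, IntegrableOn f (Metric.ball x r) :=
    integrableOn_ball_inv_normalSymbol hβ hβ' hρ
  have hshift : ∀ c, IntegrableOn (fun ξ => planeWave z ξ * f (ξ + c)) (Metric.ball 0 R) := by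
    intro c
    have h1 := ((measurePreserving_add_right volume c).integrableOn_comp_preimage
      (measurableEmbedding_addRight c)).2 (hint c R)
    have : (fun x => x + c) ⁻¹' Metric.ball c R = Metric.ball 0 R := by
      ext; simp [dist_eq_norm]
    rw [this] at h1
    exact integrable_planeWave_mul h1 z
  have h0 := integrable_planeWave_mul (hint 0 R) z
  have e1 := integral_ball_planeWave_mul_shift (planeWave_add_halfPeriod hz) f R
  have e2 := integral_ball_planeWave_mul_shift (planeWave_add_neg_halfPeriod hz) f R
  have hsplit : ∫ ξ in Metric.ball 0 R, planeWave z ξ * secondDiff β ρ (halfPeriod z) ξ =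
      2 * (∫ ξ in Metric.ball 0 R, planeWave z ξ * f ξ) -
      (∫ ξ in Metric.ball 0 R, planeWave z ξ * f (ξ + -halfPeriod z)) -
      ∫ ξ in Metric.ball 0 R, planeWave z ξ * f (ξ + halfPeriod z) := by
    have h1 : IntegrableOn (fun ξ => 2 * (planeWave z ξ * f ξ) -
        planeWave z ξ * f (ξ + -halfPeriod z)) (Metric.ball 0 R) :=
      (h0.const_mul 2).sub (hshift _)
    rw [← integral_const_mul, ← integral_sub (h0.const_mul 2) (hshift _),
      ← integral_sub h1 (hshift _)]
    refine integral_congr_ae (Eventually.of_forall fun ξ => ?_)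
    simp only [secondDiff, hf, sub_eq_add_neg]
    ring
  rw [hsplit, e1, e2]
  ring

lemma integrable_secondDiff (hβ : 3 / 5 ≤ |β|) (hβ' : |β| ≤ 1) (hρ : ρ ≠ 0) {h : ℂ} (hh : h ≠ 0) :
    Integrable (secondDiff β ρ h) :=
  ⟨(measurable_secondDiff h).aestronglyMeasurable,
    (lintegral_secondDiff_le_div hβ hβ' hρ hh).trans_lt ENNReal.ofReal_lt_top⟩

lemma halfPeriod_ne_zero {z : ℂ} (hz : z ≠ 0) : halfPeriod z ≠ 0 := by
  have : 0 < ‖z‖ := norm_pos_iff.2 hz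
  rw [← norm_pos_iff, norm_halfPeriod]; positivity

lemma tendsto_integral_ball (hβ : 3 / 5 ≤ |β|) (hβ' : |β| ≤ 1) (hρ : ρ ≠ 0) {z : ℂ} (hz : z ≠ 0) :
    Tendsto (fun R : ℝ => ∫ ξ in Metric.ball 0 R, planeWave z ξ * (normalSymbol β ρ ξ)⁻¹) atTop
      (𝓝 (4⁻¹ * ∫ ξ, planeWave z ξ * secondDiff β ρ (halfPeriod z) ξ)) := by
  have h1 := (aecover_ball (μ := volume) (x := (0 : ℂ))
    tendsto_id).integral_tendsto_of_countably_generated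
    (integrable_planeWave_mul (integrable_secondDiff hβ hβ' hρ (halfPeriod_ne_zero hz)) z)
  have h2 := ((h1.add (tendsto_integral_ball_sub hβ hβ' hρ z (halfPeriod z))).add
    (tendsto_integral_ball_sub hβ hβ' hρ z (-halfPeriod z))).const_mul (4⁻¹ : ℂ)
  rw [add_zero, add_zero] at h2
  refine h2.congr fun R => ?_
  simp only [id]
  rw [← four_mul_integral_ball hβ hβ' hρ hz]
  ring

lemma norm_integral_planeWave_mul_le {f : ℂ → ℂ} {B : ℝ} (hB0 : 0 ≤ B)
    (hB : ∫⁻ ξ, ‖f ξ‖ₑ ≤ ENNReal.ofReal B) (z : ℂ) : ‖∫ ξ, planeWave z ξ * f ξ‖ ≤ B := by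
  refine (norm_integral_le_lintegral_norm _).trans (ENNReal.toReal_le_of_le_ofReal hB0 ?_)
  refine le_trans (le_of_eq (lintegral_congr fun ξ => ?_)) hB
  rw [norm_mul, norm_planeWave, one_mul, ofReal_norm]

end Convergence

/-! ### The Faddeev symbol in normal form and the range of `β`. -/

section Green

lemma add_inv_conj_eq {lam : ℂ} (hlam : lam ≠ 0) :
    lam + 1 / conj lam = ((1 + 1 / ‖lam‖ ^ 2 : ℝ) : ℂ) * lam := by
  have hc : conj lam ≠ 0 := by simpa using hlam
  have h2 : ((‖lam‖ : ℝ) : ℂ) ^ 2 = lam * conj lam := by rw [Complex.mul_conj']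
  push_cast
  rw [h2]
  field_simp

/-- The linear part is `√E (λ conj ξ + ξ/λ)`, and `ξ/λ = |λ|⁻² conj(λ conj ξ)`. So the real and
imaginary parts of `λ conj ξ` are scaled by `1 + |λ|⁻²` and `1 - |λ|⁻²`, whose ratio is `β`. -/
lemma symbol_kvec (E : ℝ) {lam : ℂ} (hlam : lam ≠ 0) (ξ : ℂ) :
    symbol (kvec E lam) ξ = normalSymbol ((‖lam‖ ^ 2 - 1) / (‖lam‖ ^ 2 + 1))
      ((√E : ℂ) * (lam + 1 / conj lam)) ξ := by
  have h0 : 0 < ‖lam‖ := norm_pos_iff.2 hlam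
  have hc : conj lam ≠ 0 := by simpa using hlam
  have e1 : symbol (kvec E lam) ξ = ((‖ξ‖ ^ 2 : ℝ) : ℂ) + ((√E : ℝ) : ℂ) *
      (lam * conj ξ + ((1 / ‖lam‖ ^ 2 : ℝ) : ℂ) * conj (lam * conj ξ)) := by
    have h2 : ((‖lam‖ : ℝ) : ℂ) ^ 2 = lam * conj lam := by rw [Complex.mul_conj']
    have h3 : ξ = (ξ.re : ℂ) + ξ.im * Complex.I := (Complex.re_add_im ξ).symm
    have h4 : conj ξ = (ξ.re : ℂ) - ξ.im * Complex.I := by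
      apply Complex.ext <;> simp
    have h5 : ((1 / ‖lam‖ ^ 2 : ℝ) : ℂ) * conj (lam * conj ξ) = 1 / lam * ξ := by
      push_cast
      rw [h2, map_mul, Complex.conj_conj]
      field_simp
    rw [h5, h4]
    nth_rw 5 [h3]
    simp only [symbol, kvec, Matrix.cons_val_zero, Matrix.cons_val_one]
    ring
  have e2 : (√E : ℂ) * (lam + 1 / conj lam) * conj ξ =
      ((√E * (1 + 1 / ‖lam‖ ^ 2) : ℝ) : ℂ) * (lam * conj ξ) := by
    rw [add_inv_conj_eq hlam]; push_cast; ring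
  rw [e1, normalSymbol, e2]
  generalize lam * conj ξ = v
  apply Complex.ext
  · simp only [Complex.add_re, Complex.ofReal_re, Complex.re_ofReal_mul, Complex.conj_re]
    ring
  · simp only [Complex.add_im, Complex.ofReal_im, Complex.im_ofReal_mul, Complex.conj_im]
    field_simp
    ring

lemma norm_add_inv_conj {E : ℝ} {lam : ℂ} (hlam : lam ≠ 0) :
    ‖(√E : ℂ) * (lam + 1 / conj lam)‖ = √E * (‖lam‖ + 1 / ‖lam‖) := by
  have h0 : 0 < ‖lam‖ := norm_pos_iff.2 hlam
  rw [add_inv_conj_eq hlam, norm_mul, norm_mul, Complex.norm_real, Complex.norm_real,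
    Real.norm_of_nonneg (Real.sqrt_nonneg E), Real.norm_of_nonneg (by positivity)]
  field_simp

/-- The value `3/5` is attained at the excluded endpoints `r = 1/2` and `r = 2`; the quotient
vanishes at `r = 1`, where comparability fails. -/
lemma three_fifths_le_abs {r : ℝ} (hr0 : 0 < r) (hr : r ∉ Set.Icc (1 / 2 : ℝ) 2) :
    3 / 5 ≤ |(r ^ 2 - 1) / (r ^ 2 + 1)| := by
  have hp : 0 < r ^ 2 + 1 := by positivity
  rw [abs_div, abs_of_pos hp, le_div_iff₀ hp]
  rcases lt_or_ge r (1 / 2) with h | h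
  · have := neg_le_abs (r ^ 2 - 1)
    nlinarith
  · have h2 : 2 < r := by
      by_contra hc
      exact hr ⟨h, not_lt.1 hc⟩
    have := le_abs_self (r ^ 2 - 1)
    nlinarith

lemma abs_le_one_of_sq (r : ℝ) : |(r ^ 2 - 1) / (r ^ 2 + 1)| ≤ 1 := by
  have hp : 0 < r ^ 2 + 1 := by positivity
  rw [abs_div, abs_of_pos hp, div_le_one hp, abs_le]
  constructor <;> nlinarith [sq_nonneg r]

end Green

/-! ### Elementary estimates for the majorant. -/

section Majorant

lemma log_one_div_pos {τ : ℝ} (hτ : 0 < τ) (h : τ < 1 / 2) : 2 / 3 < Real.log (1 / τ) := by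
  have h2 : (2 : ℝ) ≤ 1 / τ := by rw [le_div_iff₀ hτ]; linarith
  have := Real.log_le_log two_pos h2
  linarith [Real.log_two_gt_d9]

lemma majorant_le_rpow {τ α : ℝ} (hτ : 0 < τ) (hα : 0 < α) (hα' : α ≤ 1) :
    majorant τ ≤ (1 / α + 2) / τ ^ α := by
  have hp : 0 < τ ^ α := Real.rpow_pos_of_pos hτ α
  have h0 : 0 < 1 / α := by positivity
  rw [majorant]
  split_ifs with h
  -- The summand `1/α` serves the logarithm, through `log x ≤ x^α/α`; the summand `2` serves `τ ≥
  -- 1/2`, where `τ^α ≤ 2τ`.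
  · refine (Real.log_le_rpow_div (by positivity) hα).trans ?_
    rw [one_div τ, Real.inv_rpow hτ.le]
    calc _ = 1 / α / τ ^ α := by field_simp
      _ ≤ _ := by gcongr; linarith
  · have hτ2 : 1 / 2 ≤ τ := not_lt.1 h
    rw [div_le_div_iff₀ hτ hp]
    rcases le_or_gt τ 1 with h1 | h1
    · have : τ ^ α ≤ 1 := Real.rpow_le_one hτ.le h1 hα.le
      nlinarith
    · have : τ ^ α ≤ τ ^ (1 : ℝ) := Real.rpow_le_rpow_of_exponent_le h1.le hα'
      rw [Real.rpow_one] at this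
      nlinarith

end Majorant

/-! ### Convergence and the bound for the Green function. -/

section Green

lemma integrand_eq {k : Fin 2 → ℂ} {β : ℝ} {ρ : ℂ} (hk : ∀ ξ, symbol k ξ = normalSymbol β ρ ξ)
    (z : ℂ) : integrand k z = fun ξ => planeWave z ξ * (normalSymbol β ρ ξ)⁻¹ := by
  funext ξ
  rw [integrand, planeWave, hk, div_eq_mul_inv]

variable {β : ℝ} {ρ z : ℂ} {k : Fin 2 → ℂ}

lemma tendsto_truncated (hβ : 3 / 5 ≤ |β|) (hβ' : |β| ≤ 1) (hρ : ρ ≠ 0) (hz : z ≠ 0)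
    (hk : ∀ ξ, symbol k ξ = normalSymbol β ρ ξ) :
    Tendsto (truncated k z) atTop
      (𝓝 (4⁻¹ * ∫ ξ, planeWave z ξ * secondDiff β ρ (halfPeriod z) ξ)) := by
  refine (tendsto_integral_ball hβ hβ' hρ hz).congr fun R => ?_
  rw [truncated, integrand_eq hk]

lemma converges_of_symbol_eq (hβ : 3 / 5 ≤ |β|) (hβ' : |β| ≤ 1) (hρ : ρ ≠ 0) (hz : z ≠ 0)
    (hk : ∀ ξ, symbol k ξ = normalSymbol β ρ ξ) : Converges k z := by
  refine ⟨fun R => ?_, _, tendsto_truncated hβ hβ' hρ hz hk⟩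
  rw [integrand_eq hk]
  exact integrable_planeWave_mul (integrableOn_ball_inv_normalSymbol hβ hβ' hρ 0 R) z

lemma norm_green_eq (hβ : 3 / 5 ≤ |β|) (hβ' : |β| ≤ 1) (hρ : ρ ≠ 0) (hz : z ≠ 0)
    (hk : ∀ ξ, symbol k ξ = normalSymbol β ρ ξ) : ‖green z k‖ =
      1 / (16 * Real.pi ^ 2) * ‖∫ ξ, planeWave z ξ * secondDiff β ρ (halfPeriod z) ξ‖ := by
  rw [green, (tendsto_truncated hβ hβ' hρ hz hk).limUnder_eq, norm_mul, norm_neg, norm_div,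
    norm_pow, norm_mul, norm_mul, Complex.norm_real, Real.norm_of_nonneg Real.pi_pos.le]
  norm_num
  field_simp
  ring

lemma norm_green_le (hβ : 3 / 5 ≤ |β|) (hβ' : |β| ≤ 1) (hρ : ρ ≠ 0) (hz : z ≠ 0)
    (hk : ∀ ξ, symbol k ξ = normalSymbol β ρ ξ) :
    ‖green z k‖ ≤ 360 * majorant (‖z‖ * ‖ρ‖) := by
  have hρ0 : 0 < ‖ρ‖ := norm_pos_iff.2 hρ
  have hz0 : 0 < ‖z‖ := norm_pos_iff.2 hz
  have hh := halfPeriod_ne_zero hz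
  have hπ := Real.pi_gt_three
  have hπ0 := Real.pi_pos
  have hτ : 0 < ‖z‖ * ‖ρ‖ := by positivity
  have hhρ : ‖halfPeriod z‖ / ‖ρ‖ = Real.pi / (‖z‖ * ‖ρ‖) := by
    rw [norm_halfPeriod, div_div]
  rw [norm_green_eq hβ hβ' hρ hz hk, majorant]
  split_ifs with h
  · have hlog := log_one_div_pos hτ h
    have hle : ‖ρ‖ ≤ ‖halfPeriod z‖ := by
      rw [norm_halfPeriod, le_div_iff₀ hz0]; linarith
    -- Here `2|h|/|ρ| = 2π/τ`, and `2π ≤ 8 ≤ τ⁻³` since `τ < 1/2`.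
    have hsplit : Real.log (2 * ‖halfPeriod z‖ / ‖ρ‖) ≤ 4 * Real.log (1 / (‖z‖ * ‖ρ‖)) := by
      have h4 : 2 * Real.pi ≤ (1 / (‖z‖ * ‖ρ‖)) ^ 3 := by
        have : (2 : ℝ) ≤ 1 / (‖z‖ * ‖ρ‖) := by rw [le_div_iff₀ hτ]; linarith
        calc 2 * Real.pi ≤ 2 ^ 3 := by linarith [Real.pi_lt_four]
          _ ≤ _ := by gcongr
      rw [mul_div_assoc, hhρ, show 4 * Real.log (1 / (‖z‖ * ‖ρ‖)) =
        Real.log ((1 / (‖z‖ * ‖ρ‖)) ^ 4) by rw [Real.log_pow]; norm_num]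
      refine Real.log_le_log (by positivity) ?_
      calc 2 * (Real.pi / (‖z‖ * ‖ρ‖)) = 2 * Real.pi * (1 / (‖z‖ * ‖ρ‖)) := by ring
        _ ≤ (1 / (‖z‖ * ‖ρ‖)) ^ 3 * (1 / (‖z‖ * ‖ρ‖)) := by gcongr
        _ = _ := by ring
    have hnn : 0 ≤ Real.log (2 * ‖halfPeriod z‖ / ‖ρ‖) :=
      Real.log_nonneg ((one_le_div hρ0).2 (by linarith))
    have hJ := norm_integral_planeWave_mul_le (by positivity)
      (lintegral_secondDiff_le_log hβ hβ' hρ hh hle) z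
    calc _ ≤ 1 / (16 * Real.pi ^ 2) * (5840 * Real.pi +
          160 / 3 * Real.pi * Real.log (2 * ‖halfPeriod z‖ / ‖ρ‖)) := by gcongr
      _ = 1 / (16 * Real.pi) * (5840 + 160 / 3 * Real.log (2 * ‖halfPeriod z‖ / ‖ρ‖)) := by
          field_simp
      _ ≤ 1 / (16 * 3) * (5840 + 160 / 3 * Real.log (2 * ‖halfPeriod z‖ / ‖ρ‖)) := by gcongr
      -- The bound `log(1/τ) > 2/3` absorbs the constant term.
      _ ≤ _ := by linarith
  · have hJ := norm_integral_planeWave_mul_le (by positivity)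
      (lintegral_secondDiff_le_div hβ hβ' hρ hh) z
    calc _ ≤ 1 / (16 * Real.pi ^ 2) * (5760 * Real.pi * ‖halfPeriod z‖ / ‖ρ‖) := by gcongr
      _ = 1 / (16 * Real.pi ^ 2) * (5760 * Real.pi * (Real.pi / (‖z‖ * ‖ρ‖))) := by
          rw [mul_div_assoc, hhρ]
      -- The factors `π²` cancel, leaving `5760/16 = 360`; this is the source of the constant.
      _ = _ := by field_simp; norm_num

end Green

lemma scale_eq (E : ℝ) {lam : ℂ} (hlam : lam ≠ 0) (z : ℂ) :
    scale E lam z = ‖z‖ * ‖(√E : ℂ) * (lam + 1 / conj lam)‖ := by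
  rw [norm_add_inv_conj hlam, scale, mul_assoc]

lemma sqrt_mul_add_inv_conj_ne_zero {E : ℝ} (hE : 0 < E) {lam : ℂ} (hlam : lam ≠ 0) :
    (√E : ℂ) * (lam + 1 / conj lam) ≠ 0 := by
  have : 0 < ‖lam‖ := norm_pos_iff.2 hlam
  rw [← norm_pos_iff, norm_add_inv_conj hlam]
  positivity

lemma norm_green_kvec_le {E : ℝ} (hE : 0 < E) {lam z : ℂ} (hlam : lam ≠ 0)
    (hlam' : ‖lam‖ ∉ Set.Icc (1 / 2 : ℝ) 2) (hz : z ≠ 0) :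
    ‖green z (kvec E lam)‖ ≤ 360 * majorant (scale E lam z) := by
  rw [scale_eq E hlam]
  exact norm_green_le (three_fifths_le_abs (norm_pos_iff.2 hlam) hlam') (abs_le_one_of_sq _)
    (sqrt_mul_add_inv_conj_ne_zero hE hlam) hz (symbol_kvec E hlam)

end Faddeev

theorem mainTheorem3 :
    (∀ E : ℝ, 0 < E → ∀ lam z : ℂ, lam ≠ 0 → ‖lam‖ ∉ Set.Icc (1 / 2 : ℝ) 2 → z ≠ 0 →
      Faddeev.Converges (Faddeev.kvec E lam) z) ∧
    (∃ C : ℝ, 0 < C ∧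
      ∀ E : ℝ, 0 < E → ∀ lam z : ℂ, lam ≠ 0 → ‖lam‖ ∉ Set.Icc (1 / 2 : ℝ) 2 → z ≠ 0 →
        ‖Faddeev.green z (Faddeev.kvec E lam)‖ ≤
          C * Faddeev.majorant (Faddeev.scale E lam z)) ∧
    (∀ α : ℝ, α ∈ Set.Ioc (0 : ℝ) 1 → ∃ c : ℝ, 0 < c ∧
      ∀ E : ℝ, 0 < E → ∀ lam z : ℂ, lam ≠ 0 → ‖lam‖ ∉ Set.Icc (1 / 2 : ℝ) 2 → z ≠ 0 →
        ‖Faddeev.green z (Faddeev.kvec E lam)‖ ≤ c / (Faddeev.scale E lam z) ^ α) := by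
  refine ⟨fun E hE lam z hlam hlam' hz => ?_, ⟨360, by norm_num, fun E hE lam z hlam hlam' hz =>
    Faddeev.norm_green_kvec_le hE hlam hlam' hz⟩, fun α hα => ⟨360 * (1 / α + 2), ?_, ?_⟩⟩
  · exact Faddeev.converges_of_symbol_eq
      (Faddeev.three_fifths_le_abs (norm_pos_iff.2 hlam) hlam') (Faddeev.abs_le_one_of_sq _)
      (Faddeev.sqrt_mul_add_inv_conj_ne_zero hE hlam) hz (Faddeev.symbol_kvec E hlam)
  · have := hα.1
    positivity
  · intro E hE lam z hlam hlam' hz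
    have hτ : 0 < Faddeev.scale E lam z := by
      rw [Faddeev.scale_eq E hlam]
      exact mul_pos (norm_pos_iff.2 hz)
        (norm_pos_iff.2 (Faddeev.sqrt_mul_add_inv_conj_ne_zero hE hlam))
    refine (Faddeev.norm_green_kvec_le hE hlam hlam' hz).trans ?_
    rw [mul_div_assoc]
    gcongr
    exact Faddeev.majorant_le_rpow hτ hα.1 hα.2
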